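/- \textbf{Definitions.} A \emph{small sketch} $\mathbb S=(\mathcal S,\mathsf L_{\mathbb S},\mathsf C_{\mathbb S})$ consists of a locally small, essentially small category $\mathcal S$, a class $\mathsf L_{\mathbb S}$ of cones over essentially small diagrams in $\mathcal S$ and a class $\mathsf C_{\mathbb S}$ of cocones under essentially small diagrams in $\mathcal S$. A \emph{morphism of sketches} $F:\mathbb S\to\mathbb T$ is a functor $F:\mathcal S\to\mathcal T$ such that the image of every cone in $\mathsf L_{\mathbb S}$ (cocone in $\mathsf C_{\mathbb S}$) is naturally isomorphic to a cone in $\mathsf L_{\mathbb T}$ (cocone in $\mathsf C_{\mathbb T}$). Let $\mathsf{skt}$ be the $2$-category of small sketches, morphisms of sketches and all natural transformations. A sketch is \emph{left normal} if every cocone in its class of cocones is a colimit cocone; ${}_{\mathsf{ln}}\mathsf{skt}\subseteq\mathsf{skt}$ is the full sub-$2$-category of left normal small sketches. Let $\mathbb S$ be a small sketch and $y:\mathcal S\to\mathsf{Psh}(\mathcal S)=[\mathcal S^{\mathrm{op}},\mathsf{Set}]$ the Yoneda embedding. Each $\delta:d\Rightarrow\Delta(s)$ in $\mathsf C_{\mathbb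 S}$ induces a canonical map $\rho_\delta:\operatorname{colim}(y\circ d)\to y(s)$. Let $\hat{\mathcal S}\subseteq\mathsf{Psh}(\mathcal S)$ be the full subcategory of the presheaves $X$ that are orthogonal to all $\rho_\delta$, that is, such that precomposition with $\rho_\delta$ is a bijection $\mathrm{Hom}(y(s),X)\to\mathrm{Hom}(\operatorname{colim}(y\circ d),X)$ for every $\delta\in\mathsf C_{\mathbb S}$. A \emph{biadjunction} $F\dashv G$ between pseudofunctors $F:\mathsf B\to\mathsf C$ and $G:\mathsf C\to\mathsf B$, with unit $\eta$, is a pseudonatural transformation $\eta:1_{\mathsf B}\Rightarrow GF$ such that for all $X\in\mathsf B$ and $Y\in\mathsf C$ the functor $\mathsf C(FX,Y)\to\mathsf B(X,GY)$, $g\mapsto G(g)\circ\eta_X$, is an equivalence of categories. \textbf{Theorem.} For every small sketch $\mathbb S$ the inclusion $\hat{\mathcal S}\hookrightarrow\mathsf{Psh}(\mathcal S)$ has a left adjoint $L$; put $J_{\mathbb S}=L\circ y:\mathcal S\to\hat{\mathcal S}$. The functor $J_{\mathbb S}$ has a factorisation $J_{\mathbb S}\cong R_{\mathbb S}P_{\mathbb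 S}$ into an essentially surjective functor $P_{\mathbb S}:\mathcal S\to\tilde{\mathcal S}$ followed by a fully faithful functor $R_{\mathbb S}:\tilde{\mathcal S}\to\hat{\mathcal S}$, with $\tilde{\mathcal S}$ locally small. Choose any such factorisation for every small sketch $\mathbb S$, and let $\tilde{\mathbb S}$ be the (essentially small) category $\tilde{\mathcal S}$ with the minimal sketch structure for which $P_{\mathbb S}$ is a morphism of sketches, i.e. with the cones $P_{\mathbb S}\pi$ for $\pi\in\mathsf L_{\mathbb S}$ and the cocones $P_{\mathbb S}\delta$ for $\delta\in\mathsf C_{\mathbb S}$. Then every $\tilde{\mathbb S}$ is a left normal small sketch, and $\mathbb S\mapsto\tilde{\mathbb S}$ is the object part of a pseudofunctor $\widetilde{(-)}:\mathsf{skt}\to{}_{\mathsf{ln}}\mathsf{skt}$ that is left biadjoint to the inclusion ${}_{\mathsf{ln}}\mathsf{skt}\hookrightarrow\mathsf{skt}$, by a biadjunction whose unit has the component $P_{\mathbb S}:\mathbb S\to\tilde{\mathbb S}$ at each $\mathbb S$. -/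

import Mathlib

open CategoryTheory CategoryTheory.Limits

universe w

/-- A cone in `C` over an essentially small diagram: a diagram `D ⥤ C` together with a cone
over it. -/
structure DiagramCone (C : Type (w + 1)) [Category.{w} C] : Type (w + 2) where
  shape : Type (w + 1)
  [category : Category.{w} shape]
  [small : EssentiallySmall.{w} shape]
  diagram : shape ⥤ C
  cone : Cone diagram

/-- A cocone in `C` under an essentially small diagram: a diagram `D ⥤ C` together with a cocone
under it. -/
structure DiagramCocone (C : Type (w + 1)) [Category.{w} C] : Type (w + 2) where
  shape : Type (w + 1)
  [category : Category.{w} shape]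
  [small : EssentiallySmall.{w} shape]
  diagram : shape ⥤ C
  cocone : Cocone diagram

attribute [instance] DiagramCone.category DiagramCone.small
attribute [instance] DiagramCocone.category DiagramCocone.small

/-- The image `F π` of a cone under a functor. -/
def DiagramCone.map {C D : Type (w + 1)} [Category.{w} C] [Category.{w} D] (F : C ⥤ D)
    (c : DiagramCone C) : DiagramCone D where
  shape := c.shape
  diagram := c.diagram ⋙ F
  cone := F.mapCone c.cone

/-- The image `F j` of a cocone under a functor. -/
def DiagramCocone.map {C D : Type (w + 1)} [Category.{w} C] [Category.{w} D] (F : C ⥤ D)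
    (c : DiagramCocone C) : DiagramCocone D where
  shape := c.shape
  diagram := c.diagram ⋙ F
  cocone := F.mapCocone c.cocone

/-- The cone `c` is naturally isomorphic to a member of the class `K`: there are a diagram of the
same shape with a cone over it in `K`, a natural isomorphism of the diagrams, and an isomorphism
of the cones lying over it. -/
def IsoMemCones {C : Type (w + 1)} [Category.{w} C] (K : Set (DiagramCone C))
    {D : Type (w + 1)} [Category.{w} D] [EssentiallySmall.{w} D] {d : D ⥤ C} (c : Cone d) : Prop :=
  ∃ (d' : D ⥤ C) (c' : Cone d') (α : d ≅ d'),
    (⟨D, d', c'⟩ : DiagramCone C) ∈ K ∧ Nonempty ((Cone.postcompose α.hom).obj c ≅ c')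

/-- The cocone `c` is naturally isomorphic to a member of the class `K`. -/
def IsoMemCocones {C : Type (w + 1)} [Category.{w} C] (K : Set (DiagramCocone C))
    {D : Type (w + 1)} [Category.{w} D] [EssentiallySmall.{w} D] {d : D ⥤ C}
    (c : Cocone d) : Prop :=
  ∃ (d' : D ⥤ C) (c' : Cocone d') (α : d ≅ d'),
    (⟨D, d', c'⟩ : DiagramCocone C) ∈ K ∧ Nonempty ((Cocone.precompose α.inv).obj c ≅ c')

/-- A small sketch: an essentially small category with arbitrary classes of (essentially small)
cones and cocones in it. -/
structure SmallSketch : Type (w + 2) where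
  carrier : Type (w + 1)
  [category : Category.{w} carrier]
  [small : EssentiallySmall.{w} carrier]
  cones : Set (DiagramCone carrier)
  cocones : Set (DiagramCocone carrier)

attribute [instance] SmallSketch.category SmallSketch.small

namespace SmallSketch

/-- A morphism of sketches: a functor sending each distinguished (co)cone to one that is naturally
isomorphic to a distinguished (co)cone. -/
structure Hom (S T : SmallSketch.{w}) where
  functor : S.carrier ⥤ T.carrier
  map_cones : ∀ c ∈ S.cones, IsoMemCones T.cones (functor.mapCone c.cone)
  map_cocones : ∀ c ∈ S.cocones, IsoMemCocones T.cocones (functor.mapCocone c.cocone)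

/-- The identity morphism of sketches. -/
@[simps functor]
def Hom.id (S : SmallSketch.{w}) : Hom S S where
  functor := 𝟭 _
  map_cones c hc := ⟨c.diagram, c.cone, Functor.rightUnitor _, hc,
    ⟨Cone.ext (Iso.refl _) (fun j => by simp)⟩⟩
  map_cocones c hc := ⟨c.diagram, c.cocone, Functor.rightUnitor _, hc,
    ⟨Cocone.ext (Iso.refl _) (fun j => by simp)⟩⟩

/-- Composition of morphisms of sketches. -/
@[simps functor]
def Hom.comp {S T U : SmallSketch.{w}} (F : Hom S T) (G : Hom T U) : Hom S U where
  functor := F.functor ⋙ G.functor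
  map_cones c hc := by
    obtain ⟨d, t, α, ht, ⟨e⟩⟩ := F.map_cones c hc
    obtain ⟨d', t', α', ht', ⟨e'⟩⟩ := G.map_cones _ ht
    refine ⟨d', t', Functor.isoWhiskerRight α G.functor ≪≫ α', ht', ⟨Cone.ext
      (G.functor.mapIso ((Cone.forget _).mapIso e) ≪≫ (Cone.forget _).mapIso e')
      (fun j => ?_)⟩⟩
    have h1 := e.hom.w j
    have h2 := e'.hom.w j
    simp only [Cone.postcompose_obj_π, NatTrans.comp_app, Functor.mapCone_π_app] at h1 h2
    have h3 := congrArg (fun f => G.functor.map f ≫ α'.hom.app j) h1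
    simp only [Functor.map_comp, Category.assoc] at h3
    change (G.functor.map (F.functor.map _)) ≫ G.functor.map (α.hom.app j) ≫ α'.hom.app j =
      (G.functor.map e.hom.hom ≫ e'.hom.hom) ≫ t'.π.app j
    rw [Category.assoc, h2, h3]
  map_cocones c hc := by
    obtain ⟨d, t, α, ht, ⟨e⟩⟩ := F.map_cocones c hc
    obtain ⟨d', t', α', ht', ⟨e'⟩⟩ := G.map_cocones _ ht
    refine ⟨d', t', Functor.isoWhiskerRight α G.functor ≪≫ α', ht', ⟨Cocone.ext
      (G.functor.mapIso ((Cocone.forget _).mapIso e) ≪≫ (Cocone.forget _).mapIso e')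
      (fun j => ?_)⟩⟩
    have h1 := e.hom.w j
    have h2 := e'.hom.w j
    simp only [Cocone.precompose_obj_ι, NatTrans.comp_app, Functor.mapCocone_ι_app] at h1 h2
    change ((α'.inv.app j ≫ G.functor.map (α.inv.app j)) ≫
      G.functor.map (F.functor.map (c.cocone.ι.app j))) ≫
        (G.functor.map e.hom.hom ≫ e'.hom.hom) = t'.ι.app j
    rw [← h2, ← h1]
    simp

/-- A 2-cell between morphisms of sketches: a natural transformation between the functors. -/
@[ext]
structure Hom₂ {S T : SmallSketch.{w}} (F G : Hom S T) where
  natTrans : F.functor ⟶ G.functor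

@[simps]
instance (S T : SmallSketch.{w}) : Category (Hom S T) where
  Hom F G := Hom₂ F G
  id F := ⟨𝟙 F.functor⟩
  comp α β := ⟨α.natTrans ≫ β.natTrans⟩

theorem hom₂_eq {S T : SmallSketch.{w}} {F G : Hom S T} {α β : Hom₂ F G}
    (h : ∀ x, α.natTrans.app x = β.natTrans.app x) : α = β :=
  Hom₂.ext (NatTrans.ext (funext h))

/-- An invertible 2-cell from a natural isomorphism. -/
@[simps]
def isoMk {S T : SmallSketch.{w}} {F G : Hom S T} (e : F.functor ≅ G.functor) : F ≅ G where
  hom := ⟨e.hom⟩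
  inv := ⟨e.inv⟩
  hom_inv_id := Hom₂.ext e.hom_inv_id
  inv_hom_id := Hom₂.ext e.inv_hom_id

/-- The 2-category of small sketches, morphisms of sketches and natural transformations. -/
instance : Bicategory SmallSketch.{w} where
  Hom S T := Hom S T
  homCategory S T := inferInstanceAs (Category (Hom S T))
  id S := Hom.id S
  comp F G := Hom.comp F G
  whiskerLeft F _ _ α := Hom₂.mk (Functor.whiskerLeft F.functor α.natTrans)
  whiskerRight α G := Hom₂.mk (Functor.whiskerRight α.natTrans G.functor)
  associator F G H := isoMk (F := Hom.comp (Hom.comp F G) H) (G := Hom.comp F (Hom.comp G H))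
    (Functor.associator F.functor G.functor H.functor)
  leftUnitor F := isoMk (F := Hom.comp (Hom.id _) F) (Functor.leftUnitor F.functor)
  rightUnitor F := isoMk (F := Hom.comp F (Hom.id _)) (Functor.rightUnitor F.functor)
  whiskerLeft_id _ _ := rfl
  whiskerLeft_comp _ _ _ _ _ _ := rfl
  id_whiskerLeft _ := hom₂_eq fun _ => ((Category.id_comp _).trans (Category.comp_id _)).symm
  comp_whiskerLeft _ _ _ _ _ :=
    hom₂_eq fun _ => ((Category.id_comp _).trans (Category.comp_id _)).symm
  id_whiskerRight _ G := hom₂_eq fun _ => G.functor.map_id _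
  comp_whiskerRight _ _ H := hom₂_eq fun _ => H.functor.map_comp _ _
  whiskerRight_id _ := hom₂_eq fun _ => ((Category.id_comp _).trans (Category.comp_id _)).symm
  whiskerRight_comp _ _ _ :=
    hom₂_eq fun _ => ((Category.id_comp _).trans (Category.comp_id _)).symm
  whisker_assoc _ _ _ _ _ :=
    hom₂_eq fun _ => ((Category.id_comp _).trans (Category.comp_id _)).symm
  whisker_exchange _ θ := hom₂_eq fun _ => (θ.natTrans.naturality _).symm
  pentagon _ _ _ K := hom₂_eq fun _ =>
    (congrArg (· ≫ 𝟙 _ ≫ 𝟙 _) (K.functor.map_id _)).trans (Category.id_comp _)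
  triangle _ G := hom₂_eq fun _ => (Category.id_comp _).trans (G.functor.map_id _).symm

/-- A sketch is left normal if all its distinguished cocones are colimit cocones. -/
def LeftNormal (S : SmallSketch.{w}) : Prop :=
  ∀ c ∈ S.cocones, Nonempty (IsColimit c.cocone)

end SmallSketch

/-- The full sub-2-category of small sketches on the left normal ones. -/
abbrev LeftNormalSketch : Type (w + 2) :=
  Bicategory.InducedBicategory SmallSketch.{w}
    (Subtype.val : {S : SmallSketch.{w} // S.LeftNormal} → SmallSketch.{w})

/-- A left normal small sketch as an object of the 2-category of left normal small sketches. -/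
def LeftNormalSketch.of (S : SmallSketch.{w}) (h : S.LeftNormal) : LeftNormalSketch.{w} :=
  ⟨S, h⟩

/-- The inclusion of left normal small sketches into small sketches. -/
abbrev LeftNormalSketch.inclusion : Pseudofunctor LeftNormalSketch.{w} SmallSketch.{w} :=
  Bicategory.InducedBicategory.forget.toPseudofunctor

namespace SmallSketch

instance {S : SmallSketch.{w}} (c : DiagramCocone S.carrier) :
    HasColimitsOfShape c.shape (Type w) :=
  hasColimitsOfShape_of_equivalence (equivSmallModel.{w} c.shape).symm

/-- The comparison map `ρ_δ : colim (y ∘ d) ⟶ y s` of presheaves of sets induced by a cocone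
`δ : d ⟹ Δ s`. -/
noncomputable def comparison {S : SmallSketch.{w}} (c : DiagramCocone S.carrier) :
    colimit (c.diagram ⋙ yoneda) ⟶ yoneda.obj c.cocone.pt :=
  colimit.desc (c.diagram ⋙ yoneda) (yoneda.mapCocone c.cocone)

/-- The class of the comparison maps of the distinguished cocones of `S`. -/
inductive comparisons (S : SmallSketch.{w}) : MorphismProperty (S.carrierᵒᵖ ⥤ Type w)
  | mk (c : DiagramCocone S.carrier) (hc : c ∈ S.cocones) : comparisons S (comparison c)

/-- The underlying category of the left sketch classifier of `S`: the full subcategory of the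
presheaves of sets that are orthogonal to all the comparison maps. -/
abbrev Classifier (S : SmallSketch.{w}) : Type (w + 1) :=
  S.comparisons.isLocal.FullSubcategory

/-- The inclusion of the classifier into presheaves. -/
abbrev classifierInclusion (S : SmallSketch.{w}) : S.Classifier ⥤ (S.carrierᵒᵖ ⥤ Type w) :=
  S.comparisons.isLocal.ι

/-- The functor from `S` to its left sketch classifier: the Yoneda embedding followed by the
reflection of presheaves onto the classifier. -/
noncomputable def toClassifier (S : SmallSketch.{w}) [S.classifierInclusion.IsRightAdjoint] :
    S.carrier ⥤ S.Classifier :=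
  yoneda ⋙ S.classifierInclusion.leftAdjoint

/-- A left normalisation of `S`, before the middle category gets its sketch structure: a
factorisation of `J_S`, up to isomorphism, into an essentially surjective functor `P` followed by a
fully faithful functor `R`, through a locally small category. -/
structure Factorisation (S : SmallSketch.{w}) [S.classifierInclusion.IsRightAdjoint] where
  middle : Type (w + 1)
  [category : Category.{w} middle]
  P : S.carrier ⥤ middle
  R : middle ⥤ S.Classifier
  essSurj : P.EssSurj
  full : R.Full
  faithful : R.Faithful
  iso : P ⋙ R ≅ S.toClassifier

attribute [instance] Factorisation.category

namespace Factorisation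

variable {S : SmallSketch.{w}} [S.classifierInclusion.IsRightAdjoint] (N : S.Factorisation)

theorem essentiallySmall_middle : EssentiallySmall.{w} N.middle := by
  have := N.essSurj
  refine (essentiallySmall_iff N.middle).2 ⟨?_, inferInstance⟩
  refine small_of_surjective (f := fun x : SmallModel.{w} S.carrier =>
    toSkeleton (N.P.obj ((equivSmallModel S.carrier).inverse.obj x))) fun X => ?_
  obtain ⟨Y, rfl⟩ := Quotient.exists_rep X
  refine ⟨(equivSmallModel S.carrier).functor.obj (N.P.objPreimage Y), Quotient.sound ⟨?_⟩⟩
  exact N.P.mapIso ((equivSmallModel S.carrier).unitIso.symm.app _) ≪≫ N.P.objObjPreimageIso Y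

/-- The left normalisation: the middle category with the minimal sketch structure for which `P` is
a morphism of sketches, whose (co)cones are exactly the images under `P` of those of `S`. -/
def sketch : SmallSketch.{w} where
  carrier := N.middle
  small := N.essentiallySmall_middle
  cones := DiagramCone.map N.P '' S.cones
  cocones := DiagramCocone.map N.P '' S.cocones

/-- The functor `P` as a morphism of sketches from `S` to its left normalisation. -/
def unit : S ⟶ N.sketch where
  functor := N.P
  map_cones c hc := ⟨_, _, Iso.refl _, Set.mem_image_of_mem _ hc,
    ⟨Cone.ext (Iso.refl _) (fun j => (Category.comp_id (N.P.map (c.cone.π.app j))).trans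
      (Category.id_comp _).symm)⟩⟩
  map_cocones _ hc := ⟨_, _, Iso.refl _, Set.mem_image_of_mem _ hc,
    ⟨Cocone.ext (Iso.refl _) (fun _ => (Category.comp_id _).trans (Category.id_comp _))⟩⟩

end Factorisation

end SmallSketch

/-- A biadjunction `F ⊣ G` between bicategories, given by its unit: a pseudonatural
transformation `η : 𝟙 ⟹ G F` such that for all `X` and `Y` the functor
`(F X ⟶ Y) ⥤ (X ⟶ G Y)`, `g ↦ G g ∘ η_X`, is an equivalence of categories. These equivalences
are pseudonatural in `X` by the pseudonaturality of `η`, and in `Y` by the pseudofunctoriality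
of `G`. -/
structure Biadjunction {B C : Type*} [Bicategory B] [Bicategory C]
    (F : Pseudofunctor B C) (G : Pseudofunctor C B) where
  unit : Pseudofunctor.StrongTrans (Pseudofunctor.id B) (F.comp G)
  isEquivalence (X : B) (Y : C) :
    (G.mapFunctor (F.obj X) Y ⋙ Bicategory.precomp (G.obj Y) (unit.app X)).IsEquivalence

/-!
The class of distinguished cocones of a sketch `S` may be proper, so the existence of the
reflection of presheaves onto the classifier is not an instance of the small orthogonal
subcategory theorem. What makes it work is that all comparison maps have representable codomain.
Consider the product of all presheaves `Y` in the classifier, one factor for each map `A ⟶ Y`, and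
in it the smallest subpresheaf that contains the image of `A` and is closed under amalgamation over
those sieves for which all such `Y` are separated. Its sections are denoted by well-founded
expressions built from sections of `A`, restrictions, and families indexed by sieves. A small
category has only a small set of sieves, so this subpresheaf is small, and it is the reflection of
`A`: an extension problem along a comparison map is solved in each factor, and the solution is an
amalgamation over the image sieve of the comparison map (`PresheafReflection.isLocal_reflection`,
`SmallSketch.isRightAdjoint_classifierInclusion`).

The functor `J` sends distinguished cocones to colimit cocones, because the reflection preserves
colimits and inverts the comparison maps. Since `J ≅ P ⋙ R` with `R` fully faithful, `P` sends them
to colimit cocones as well, so the left normalisation is left normal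
(`SmallSketch.Factorisation.leftNormal_sketch`).

The universal property rests on one fact: the presheaf `a ↦ (P a ⟶ P b)` on `S` is the reflection of
the presheaf represented by `b`, so maps from it into a presheaf `X` in the classifier are sections
of `X` over `b` (`SmallSketch.Factorisation.existsUnique_natTrans`). If `f : S ⟶ T` is a morphism
into a left normal sketch, all presheaves `a ↦ (f a ⟶ t)` are in the classifier, and the existence
of maps `(P a ⟶ P b) → (f a ⟶ f b)` preserving identities extends `f` along `P`; functoriality, and
the extension of natural transformations, follow from uniqueness. Hence precomposition with `P` is
an equivalence of hom categories
(`SmallSketch.Factorisation.isEquivalence_precomp_unit`). Finally, universal arrows into a full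
sub-bicategory assemble into a biadjunction (`BiadjunctionOfUniversal.biadjunction`); the coherence
axioms are checked after whiskering with the universal arrows, which is faithful.
-/

open Opposite

/-! ### Reflection of presheaves onto an orthogonality class -/

namespace PresheafReflection

variable {C : Type w} [SmallCategory C]

/-- Formal expressions for the sections of the reflection of `A`: sections of `A`, restrictions of
expressions, and amalgamations of a family of expressions indexed by a sieve. There is no
compatibility condition on the family; whether an expression denotes anything is decided by
`SectionTerm.Eval`. The expressions form a type in `Type w` because `C` is small. -/
inductive SectionTerm (A : Cᵒᵖ ⥤ Type w) : C → Type w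
  | of {c : C} (x : A.obj (op c)) : SectionTerm A c
  | res {c d : C} (g : d ⟶ c) (t : SectionTerm A c) : SectionTerm A d
  | glue {c : C} (I : Sieve c) (t : ∀ ⦃d : C⦄ (g : d ⟶ c), I g → SectionTerm A d) : SectionTerm A c

variable (P : ObjectProperty (Cᵒᵖ ⥤ Type w)) (A : Cᵒᵖ ⥤ Type w)

/-- Sections over `c` of the product of all presheaves `Y` satisfying `P`, one factor for each
`A ⟶ Y`. -/
abbrev Family (c : C) : Type (w + 1) :=
  ∀ (Y : Cᵒᵖ ⥤ Type w) (_ : P Y) (_ : A ⟶ Y), Y.obj (op c)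

variable {P A}

/-- Restriction of a family along a morphism, factor by factor. -/
def Family.restrict {c d : C} (y : Family P A c) (g : d ⟶ c) : Family P A d :=
  fun Y hY h => Y.map g.op (y Y hY h)

@[simp]
theorem Family.restrict_id {c : C} (y : Family P A c) : y.restrict (𝟙 c) = y := by
  funext Y hY h
  simp [Family.restrict]

@[simp]
theorem Family.restrict_comp {c d e : C} (y : Family P A c) (g : d ⟶ c) (k : e ⟶ d) :
    y.restrict (k ≫ g) = (y.restrict g).restrict k := by
  funext Y hY h
  simp [Family.restrict]

/-- `t.Eval y` says that the expression `t` denotes the family `y`. An amalgamation over a sieve `I`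
is only allowed to denote something if all presheaves satisfying `P` are separated for `I`, which is
what makes the denoted family unique. -/
def SectionTerm.Eval : ∀ {c : C}, SectionTerm A c → Family P A c → Prop
  | _, .of x, y => y = fun _ _ h => h.app _ x
  | _, .res g t, y => ∃ z : Family P A _, t.Eval z ∧ y = z.restrict g
  | _, .glue I t, y => (∀ Y, P Y → I.arrows.IsSeparatedFor Y) ∧
      ∀ ⦃d⦄ (g : d ⟶ _) (hg : I g), (t g hg).Eval (y.restrict g)

theorem SectionTerm.Eval.unique {c : C} (t : SectionTerm A c) {y z : Family P A c} (hy : t.Eval y)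
    (hz : t.Eval z) : y = z := by
  induction t with
  | of x => exact Eq.trans hy (Eq.symm hz)
  | res g t ih =>
    obtain ⟨y', hy', rfl⟩ := hy
    obtain ⟨z', hz', rfl⟩ := hz
    rw [ih hy' hz']
  | glue I t ih =>
    funext Y hY h
    refine (hy.1 Y hY).ext fun d g hg => ?_
    exact congrFun (congrFun (congrFun (ih g hg (hy.2 g hg) (hz.2 g hg)) Y) hY) h

variable (P A)

/-- The families that are denoted by some expression. -/
abbrev GeneratedFamily (c : C) : Type (w + 1) :=
  {y : Family P A c // ∃ t : SectionTerm A c, t.Eval y}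

/-- Mapping a generated family to an expression denoting it is injective, so that the generated
families form a small set, although they are sections of a product over a proper class. -/
instance (c : C) : Small.{w} (GeneratedFamily P A c) :=
  small_of_injective (f := fun y : GeneratedFamily P A c => y.2.choose) fun y z h => by
    have hz := z.2.choose_spec
    rw [← show y.2.choose = z.2.choose from h] at hz
    exact Subtype.ext (SectionTerm.Eval.unique _ y.2.choose_spec hz)

/-- The presheaf of generated families, the candidate for the reflection of `A` onto the presheaves
satisfying `P`. -/
noncomputable def reflection : Cᵒᵖ ⥤ Type w where
  obj c := Shrink.{w} (GeneratedFamily P A c.unop)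
  map g := TypeCat.ofHom fun y => equivShrink _
    ⟨((equivShrink (GeneratedFamily P A _)).symm y).1.restrict g.unop,
      .res g.unop ((equivShrink (GeneratedFamily P A _)).symm y).2.choose, _,
      ((equivShrink (GeneratedFamily P A _)).symm y).2.choose_spec, rfl⟩
  map_id c := by
    refine ConcreteCategory.hom_ext _ _ fun y =>
      (equivShrink (GeneratedFamily P A _)).symm.injective (Subtype.ext ?_)
    simp
  map_comp f g := by
    refine ConcreteCategory.hom_ext _ _ fun y =>
      (equivShrink (GeneratedFamily P A _)).symm.injective (Subtype.ext ?_)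
    simp

variable {P A}

/-- The family underlying a section of the reflection. -/
noncomputable def reflection.val {c : Cᵒᵖ} (y : (reflection P A).obj c) : Family P A c.unop :=
  ((equivShrink (GeneratedFamily P A c.unop)).symm y).1

/-- The section of the reflection given by a generated family. -/
noncomputable def reflection.mk {c : Cᵒᵖ} (y : Family P A c.unop)
    (h : ∃ t : SectionTerm A c.unop, t.Eval y) :
    (reflection P A).obj c :=
  equivShrink (GeneratedFamily P A c.unop) ⟨y, h⟩

@[simp]
theorem reflection.val_mk {c : Cᵒᵖ} (y : Family P A c.unop)
    (h : ∃ t : SectionTerm A c.unop, t.Eval y) :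
    reflection.val (reflection.mk y h) = y := by
  simp [reflection.val, reflection.mk]

theorem reflection.exists_eval {c : Cᵒᵖ} (y : (reflection P A).obj c) :
    ∃ t : SectionTerm A c.unop, t.Eval (reflection.val y) :=
  ((equivShrink (GeneratedFamily P A c.unop)).symm y).2

theorem reflection.ext {c : Cᵒᵖ} {y z : (reflection P A).obj c}
    (h : reflection.val y = reflection.val z) : y = z :=
  (equivShrink _).symm.injective (Subtype.ext h)

@[simp]
theorem reflection.val_map {c d : Cᵒᵖ} (g : c ⟶ d) (y : (reflection P A).obj c) :
    reflection.val ((reflection P A).map g y) = (reflection.val y).restrict g.unop := by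
  change ((equivShrink (GeneratedFamily P A _)).symm (equivShrink (GeneratedFamily P A _) _)).1 = _
  rw [Equiv.symm_apply_apply]
  rfl

variable (P A) in
/-- The canonical map from `A` to its reflection. -/
noncomputable def toReflection : A ⟶ reflection P A where
  app c := TypeCat.ofHom fun x => reflection.mk (fun _ _ h => h.app _ x) ⟨.of x, rfl⟩
  naturality c d g := by
    ext x
    apply reflection.ext
    funext Y hY h
    simp [Family.restrict]

@[simp]
theorem reflection.val_toReflection {c : Cᵒᵖ} (x : A.obj c) :
    reflection.val ((toReflection P A).app c x) = fun _ _ h => h.app _ x := by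
  simp [toReflection]

/-- The factorisation of a map `h : A ⟶ Y`, where `Y` satisfies `P`, through the reflection: the
projection onto the factor indexed by `h`. -/
noncomputable def reflection.desc {Y : Cᵒᵖ ⥤ Type w} (hY : P Y) (h : A ⟶ Y) :
    reflection P A ⟶ Y where
  app c := TypeCat.ofHom fun y => reflection.val y Y hY h
  naturality c d g := by
    ext y
    simp [Family.restrict]

@[simp]
theorem reflection.desc_app {Y : Cᵒᵖ ⥤ Type w} (hY : P Y) (h : A ⟶ Y) {c : Cᵒᵖ}
    (y : (reflection P A).obj c) : (reflection.desc hY h).app c y = reflection.val y Y hY h := rfl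

/-- Maps from the reflection into a presheaf `Y` satisfying `P` correspond to maps from `A` into
`Y`. Uniqueness is by induction on expressions. -/
theorem isLocal_toReflection : P.isLocal (toReflection P A) := by
  intro Y hY
  refine ⟨fun a b hab => ?_, fun h => ⟨reflection.desc hY h, ?_⟩⟩
  -- Two maps that agree on `A` agree on every section denoted by an expression.
  · have key : ∀ {c : C} (t : SectionTerm A c) (y : (reflection P A).obj (op c)),
        t.Eval (reflection.val y) → a.app _ y = b.app _ y := by
      intro c t
      induction t with
      | of x =>
        intro y hy
        have : y = (toReflection P A).app _ x :=
          reflection.ext (hy.trans (reflection.val_toReflection x).symm)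
        subst this
        exact congr($(congrArg (fun k => NatTrans.app k _) hab) x)
      | res g t ih =>
        rintro y ⟨z, hz, hy⟩
        have : y = (reflection P A).map g.op (reflection.mk z ⟨t, hz⟩) :=
          reflection.ext (by simpa using hy)
        subst this
        rw [NatTrans.naturality_apply, NatTrans.naturality_apply, ih _ (by simpa using hz)]
      | glue I t ih =>
        intro y hy
        refine (hy.1 Y hY).ext fun d g hg => ?_
        rw [← NatTrans.naturality_apply, ← NatTrans.naturality_apply]
        exact ih g hg _ (by simpa using hy.2 g hg)
    ext c y
    obtain ⟨t, ht⟩ := reflection.exists_eval y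
    exact key t y ht
  · ext c x
    simp

variable {ι : Type*} {s : ι → C} {K : ι → Cᵒᵖ ⥤ Type w} (f : ∀ i, K i ⟶ yoneda.obj (s i))

/-- The sieve on `c` that is the image of a map of presheaves into `yoneda.obj c`. -/
def imageSieve {c : C} {K : Cᵒᵖ ⥤ Type w} (f : K ⟶ yoneda.obj c) : Sieve c where
  arrows d g := ∃ k : K.obj (op d), f.app _ k = g
  downward_closed := by
    rintro d e g ⟨k, rfl⟩ h
    exact ⟨K.map h.op k, by rw [NatTrans.naturality_apply]; rfl⟩

theorem yonedaEquiv_symm_app_app {c : C} {K Y : Cᵒᵖ ⥤ Type w} (f : K ⟶ yoneda.obj c)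
    (a : Y.obj (op c)) {d : Cᵒᵖ} (k : K.obj d) :
    (yonedaEquiv.symm a).app d (f.app d k) = Y.map (f.app d k : d.unop ⟶ c).op a :=
  yonedaEquiv_symm_app_apply _ _ _

theorem isSeparatedFor_imageSieve {c : C} {K : Cᵒᵖ ⥤ Type w} (f : K ⟶ yoneda.obj c)
    {Y : Cᵒᵖ ⥤ Type w} (hY : Function.Injective fun g : yoneda.obj c ⟶ Y => f ≫ g) :
    (imageSieve f).arrows.IsSeparatedFor Y := by
  intro x a b ha hb
  refine yonedaEquiv.symm.injective (hY ?_)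
  ext d k
  change (yonedaEquiv.symm a).app d (f.app d k) = (yonedaEquiv.symm b).app d (f.app d k)
  rw [yonedaEquiv_symm_app_app, yonedaEquiv_symm_app_app]
  exact (ha _ ⟨k, rfl⟩).trans (hb _ ⟨k, rfl⟩).symm

/-- The reflection onto the presheaves orthogonal to maps with representable codomain is itself
orthogonal to these maps. No smallness of the index type `ι` is needed: an extension problem along
`f i` is solved by amalgamating over the image sieve of `f i`, and there is only a small set of
sieves. -/
theorem isLocal_reflection (P : ObjectProperty (Cᵒᵖ ⥤ Type w))
    (hP : P = (MorphismProperty.ofHoms f).isLocal) : P (reflection P A) := by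
  have hf : ∀ Y, P Y → ∀ i, Function.Bijective fun g : yoneda.obj (s i) ⟶ Y => f i ≫ g :=
    fun Y hY i => by
      rw [hP] at hY
      exact hY _ ⟨i⟩
  have main : ∀ i, Function.Bijective fun g : yoneda.obj (s i) ⟶ reflection P A => f i ≫ g := by
    intro i
    refine ⟨fun a b hab => ?_, fun u => ?_⟩
    · apply yonedaEquiv.injective
      apply reflection.ext
      funext Y hY h
      have := (hf Y hY i).1 (a₁ := a ≫ reflection.desc hY h) (a₂ := b ≫ reflection.desc hY h)
        (by simpa using congrArg (· ≫ reflection.desc hY h) hab)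
      exact congrArg yonedaEquiv this
    -- Extend `u` in each factor of the product; the resulting family is an amalgamation over the
    -- image sieve of `f i` of expressions for values of `u`.
    · choose y hy using fun (Y : Cᵒᵖ ⥤ Type w) (hY : P Y) (h : A ⟶ Y) =>
        (hf Y hY i).2 (u ≫ reflection.desc hY h)
      have hy' : ∀ (Y : Cᵒᵖ ⥤ Type w) (hY : P Y) (h : A ⟶ Y) (d : Cᵒᵖ) (k : (K i).obj d),
          Y.map ((f i).app d k : d.unop ⟶ s i).op (yonedaEquiv (y Y hY h)) =
            reflection.val (u.app d k) Y hY h := by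
        intro Y hY h d k
        rw [map_yonedaEquiv]
        exact congr($(congrArg (fun k => NatTrans.app k d) (hy Y hY h)) k)
      have gen : ∃ t : SectionTerm A (s i),
          t.Eval (P := P) fun Y hY h => yonedaEquiv (y Y hY h) := by
        choose t ht using fun (d : Cᵒᵖ) (x : (reflection P A).obj d) => reflection.exists_eval x
        refine ⟨.glue (imageSieve (f i)) fun d g hg => t _ (u.app (op d) hg.choose), ?_, ?_⟩
        · exact fun Y hY => isSeparatedFor_imageSieve _ (hf Y hY i).1
        · intro d g hg
          convert ht _ (u.app (op d) hg.choose) using 1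
          funext Y hY h
          rw [← hy' Y hY h]
          exact congrArg (fun g : d ⟶ s i => Y.map g.op (yonedaEquiv (y Y hY h)))
            hg.choose_spec.symm
      refine ⟨yonedaEquiv.symm (reflection.mk (c := op (s i)) _ gen), ?_⟩
      ext d k
      apply reflection.ext
      refine (congrArg reflection.val (yonedaEquiv_symm_app_app (f i) _ k)).trans ?_
      rw [reflection.val_map, reflection.val_mk]
      funext Y hY h
      exact hy' Y hY h d k
  rw [hP]
  rintro _ _ _ ⟨i⟩
  exact hP ▸ main i

end PresheafReflection

/-! ### Reflectivity of the classifier -/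

theorem bijective_precomp_map_iff {C D : Type*} [Category* C] [Category* D] {L : C ⥤ D}
    {R : D ⥤ C} (adj : L ⊣ R) {A B : C} (f : A ⟶ B) (X : D) :
    (Function.Bijective fun g : L.obj B ⟶ X => L.map f ≫ g) ↔
      Function.Bijective fun g : B ⟶ R.obj X => f ≫ g := by
  have h : (fun g : B ⟶ R.obj X => f ≫ g) ∘ adj.homEquiv B X =
      adj.homEquiv A X ∘ fun g : L.obj B ⟶ X => L.map f ≫ g := by
    funext g
    exact (adj.homEquiv_naturality_left f g).symm
  rw [← (adj.homEquiv A X).bijective.of_comp_iff', ← h, Equiv.bijective_comp]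

theorem isRightAdjoint_ι_of_exists_isLocal {D : Type*} [Category* D] (P : ObjectProperty D)
    (h : ∀ A, ∃ (Z : D) (u : A ⟶ Z), P Z ∧ P.isLocal u) : P.ι.IsRightAdjoint := by
  rw [Functor.isRightAdjoint_iff_leftAdjointObjIsDefined_eq_top]
  ext A
  obtain ⟨Z, u, hZ, hu⟩ := h A
  let r : (P.ι ⋙ coyoneda.obj (op A)).CorepresentableBy ⟨Z, hZ⟩ :=
    { homEquiv {Y} := (ObjectProperty.fullyFaithfulι _).homEquiv.trans
        (Equiv.ofBijective _ (hu _ Y.2))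
      homEquiv_comp _ _ := by simp [Functor.FullyFaithful.homEquiv] }
  simpa using! r.isCorepresentable

namespace SmallSketch

/-- The classifier is reflective in presheaves. The proof moves the problem along an equivalence to
presheaves on a small model of the category, where the construction of `PresheafReflection`
applies. -/
theorem isRightAdjoint_classifierInclusion (S : SmallSketch.{w}) :
    S.classifierInclusion.IsRightAdjoint := by
  let E := equivSmallModel.{w} S.carrier
  let e : (S.carrierᵒᵖ ⥤ Type w) ≌ ((SmallModel.{w} S.carrier)ᵒᵖ ⥤ Type w) := E.op.congrLeft
  -- The equivalence of presheaf categories preserves representables.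
  let θ (a : S.carrier) : e.functor.obj (yoneda.obj a) ≅ yoneda.obj (E.functor.obj a) :=
    NatIso.ofComponents (fun b => (E.symm.toAdjunction.homEquiv b.unop a).toIso) fun g => by
      ext k
      exact E.symm.toAdjunction.homEquiv_naturality_left g.unop k
  let f (c : S.cocones) : e.functor.obj (colimit (c.1.diagram ⋙ yoneda)) ⟶
      yoneda.obj (E.functor.obj c.1.cocone.pt) := e.functor.map (comparison c.1) ≫ (θ _).hom
  let P := (MorphismProperty.ofHoms f).isLocal
  have hP (X) : P X ↔ S.comparisons.isLocal (e.inverse.obj X) := by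
    have key (c : S.cocones) : (Function.Bijective fun g : _ ⟶ X => f c ≫ g) ↔
        Function.Bijective fun g : _ ⟶ e.inverse.obj X => comparison c.1 ≫ g := by
      rw [← bijective_precomp_map_iff e.toAdjunction,
        ← Function.Bijective.of_comp_iff _ ((θ c.1.cocone.pt).homFromEquiv (Z := X)).bijective]
      have : (fun g : _ ⟶ X => f c ≫ g) ∘ (θ c.1.cocone.pt).homFromEquiv =
          fun g => e.functor.map (comparison c.1) ≫ g := by
        funext g
        simp [f]
      rw [this]
    constructor
    · rintro h _ _ _ ⟨c, hc⟩
      exact (key ⟨c, hc⟩).1 (h _ (MorphismProperty.ofHoms.mk (f := f) ⟨c, hc⟩))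
    · rintro h _ _ _ ⟨c⟩
      exact (key c).2 (h _ ⟨c.1, c.2⟩)
  refine isRightAdjoint_ι_of_exists_isLocal _ fun A => ?_
  refine ⟨e.inverse.obj (PresheafReflection.reflection P (e.functor.obj A)),
    e.unit.app A ≫ e.inverse.map (PresheafReflection.toReflection P (e.functor.obj A)),
    (hP _).1 (PresheafReflection.isLocal_reflection f P rfl), ?_⟩
  refine MorphismProperty.comp_mem _ _ _ (ObjectProperty.isLocal_of_isIso _ _) fun Y hY => ?_
  refine (bijective_precomp_map_iff e.symm.toAdjunction _ _).2 ?_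
  refine PresheafReflection.isLocal_toReflection _ ((hP _).2 ?_)
  exact S.comparisons.isLocal.prop_of_iso (e.unitIso.app Y) hY

end SmallSketch

/-! ### The left normalisation -/

namespace SmallSketch

variable (S : SmallSketch.{w}) [S.classifierInclusion.IsRightAdjoint]

/-- The adjunction of the reflection of presheaves onto the classifier. -/
noncomputable abbrev classifierAdj : S.classifierInclusion.leftAdjoint ⊣ S.classifierInclusion :=
  Adjunction.ofIsRightAdjoint _

/-- The defining property of `J = S.toClassifier`: maps `J a ⟶ X` are sections of `X` over `a`, by
the adjunction and the Yoneda lemma. -/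
noncomputable def toClassifierHomEquiv (a : S.carrier) (X : S.Classifier) :
    (S.toClassifier.obj a ⟶ X) ≃ X.obj.obj (op a) :=
  (S.classifierAdj.homEquiv _ _).trans yonedaEquiv

variable {S} in
theorem toClassifierHomEquiv_comp {a : S.carrier} {X Y : S.Classifier}
    (g : S.toClassifier.obj a ⟶ X) (h : X ⟶ Y) :
    S.toClassifierHomEquiv a Y (g ≫ h) = h.hom.app _ (S.toClassifierHomEquiv a X g) :=
  (congrArg yonedaEquiv (S.classifierAdj.homEquiv_naturality_right g h)).trans
    (yonedaEquiv_comp _ _)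

variable {S} in
theorem toClassifierHomEquiv_map_comp {a b : S.carrier} (k : a ⟶ b) {X : S.Classifier}
    (g : S.toClassifier.obj b ⟶ X) :
    S.toClassifierHomEquiv a X (S.toClassifier.map k ≫ g) =
      X.obj.map k.op (S.toClassifierHomEquiv b X g) :=
  (congrArg yonedaEquiv (S.classifierAdj.homEquiv_naturality_left (yoneda.map k) g)).trans
    (yonedaEquiv_naturality _ _).symm

/-- A factorisation of `J` through its full image. The homs of the classifier live one universe too
high; they are small here by `toClassifierHomEquiv`. -/
theorem nonempty_factorisation : Nonempty S.Factorisation := by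
  let I := InducedCategory S.Classifier S.toClassifier.obj
  have : LocallySmall.{w} I := ⟨fun a b =>
    ⟨_, ⟨InducedCategory.homEquiv.trans
      (S.toClassifierHomEquiv (show S.carrier from a) (S.toClassifier.obj b))⟩⟩⟩
  let P : S.carrier ⥤ I :=
    { obj a := a
      map k := InducedCategory.homMk (S.toClassifier.map k) }
  exact ⟨{
    middle := ShrinkHoms I
    P := P ⋙ (ShrinkHoms.equivalence I).functor
    R := (ShrinkHoms.equivalence I).inverse ⋙ inducedFunctor _
    essSurj := ⟨fun a => ⟨a, ⟨Iso.refl _⟩⟩⟩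
    full := inferInstance
    faithful := inferInstance
    iso := Functor.isoWhiskerLeft P (Functor.isoWhiskerRight (ShrinkHoms.equivalence I).unitIso.symm
      (inducedFunctor _)) }⟩

variable {S}

/-- The reflection inverts the comparison maps, since the objects of the classifier are orthogonal
to them. -/
theorem isIso_map_comparison (c : DiagramCocone S.carrier) (hc : c ∈ S.cocones) :
    IsIso (S.classifierInclusion.leftAdjoint.map (comparison c)) := by
  rw [isIso_iff_coyoneda_map_bijective]
  exact fun X => (bijective_precomp_map_iff S.classifierAdj _ X).2 (X.property _ ⟨c, hc⟩)

theorem nonempty_isColimit_mapCocone_toClassifier (c : DiagramCocone S.carrier)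
    (hc : c ∈ S.cocones) : Nonempty (IsColimit (S.toClassifier.mapCocone c.cocone)) := by
  let L := S.classifierInclusion.leftAdjoint
  have := isIso_map_comparison c hc
  have : PreservesColimitsOfSize.{w, w + 1} L := S.classifierAdj.leftAdjoint_preservesColimits
  have h : IsColimit (L.mapCocone (yoneda.mapCocone c.cocone)) :=
    (isColimitOfPreserves L (colimit.isColimit (c.diagram ⋙ yoneda))).ofIsoColimit
      (Cocone.ext (asIso (L.map (comparison c))) fun j => by
        simp [← Functor.map_comp, comparison])
  exact ⟨h⟩

namespace Factorisation
variable (N : S.Factorisation)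

/-- `R` reflects the colimits into which `J ≅ P ⋙ R` turns the distinguished cocones. -/
theorem leftNormal_sketch : N.sketch.LeftNormal := by
  have := N.full
  have := N.faithful
  rintro _ ⟨c, hc, rfl⟩
  obtain ⟨h⟩ := nonempty_isColimit_mapCocone_toClassifier c hc
  exact ⟨isColimitOfReflects N.R ((IsColimit.mapCoconeEquiv N.iso.symm) h)⟩

/-- The functor `R` is fully faithful. -/
noncomputable def fullyFaithful : N.R.FullyFaithful :=
  have := N.full
  have := N.faithful
  .ofFullyFaithful N.R

/-- The presheaf `a ↦ (P a ⟶ P b)` is the reflection of `yoneda.obj b`. -/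
noncomputable def homIso (b : S.carrier) :
    N.P.op ⋙ yoneda.obj (N.P.obj b) ≅ (S.toClassifier.obj b).obj :=
  NatIso.ofComponents (fun a => Equiv.toIso <| N.fullyFaithful.homEquiv.trans <|
    ((N.iso.app a.unop).homCongr (N.iso.app b)).trans
      (S.toClassifierHomEquiv a.unop (S.toClassifier.obj b))) fun {a a'} k => by
    ext φ
    simp [Functor.FullyFaithful.homEquiv, Iso.homCongr]
    refine Eq.trans ?_ (toClassifierHomEquiv_map_comp k.unop _)
    congr 1
    simp

theorem homIso_hom_app_id (b : S.carrier) :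
    (N.homIso b).hom.app (op b) (𝟙 (N.P.obj b)) =
      S.toClassifierHomEquiv b (S.toClassifier.obj b) (𝟙 _) := by
  simp [homIso, Functor.FullyFaithful.homEquiv, Iso.homCongr]

/-- The universal property of the homs of the left normalisation: a map from the presheaf
`a ↦ (P a ⟶ P b)` into a presheaf in the classifier is determined by its value at the identity
of `P b`, which can be prescribed arbitrarily. -/
theorem existsUnique_natTrans {b : S.carrier} {X : S.carrierᵒᵖ ⥤ Type w}
    (hX : S.comparisons.isLocal X) (x : X.obj (op b)) :
    ∃! θ : N.P.op ⋙ yoneda.obj (N.P.obj b) ⟶ X, θ.app (op b) (𝟙 (N.P.obj b)) = x := by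
  let X' : S.Classifier := ⟨X, hX⟩
  have key (g : S.toClassifier.obj b ⟶ X') :
      ((N.homIso b).hom ≫ g.hom).app (op b) (𝟙 (N.P.obj b)) = S.toClassifierHomEquiv b X' g := by
    refine (congrArg (g.hom.app (op b)) (N.homIso_hom_app_id b)).trans ?_
    rw [← toClassifierHomEquiv_comp, Category.id_comp]
  refine ⟨(N.homIso b).hom ≫ ((S.toClassifierHomEquiv b X').symm x).hom, ?_, fun θ hθ => ?_⟩
  · exact (key _).trans (Equiv.apply_symm_apply _ _)
  · let g : S.toClassifier.obj b ⟶ X' := ⟨(N.homIso b).inv ≫ θ⟩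
    have hg : θ = (N.homIso b).hom ≫ g.hom := by simp [g]
    have : S.toClassifierHomEquiv b X' g = x := by rw [← key g, ← hg, hθ]
    rw [hg, ← this, Equiv.symm_apply_apply]

end Factorisation
end SmallSketch

/-! ### The universal property of the left normalisation -/

theorem IsoMemCones.of_iso {C D : Type (w + 1)} [Category.{w} C] [Category.{w} D]
    {K : Set (DiagramCone D)} {J : Type (w + 1)} [Category.{w} J] [EssentiallySmall.{w} J]
    {d : J ⥤ C} {c : Cone d} {F G : C ⥤ D} (e : F ≅ G) (h : IsoMemCones K (G.mapCone c)) :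
    IsoMemCones K (F.mapCone c) := by
  obtain ⟨d', c', α, hc', ⟨i⟩⟩ := h
  refine ⟨d', c', Functor.isoWhiskerLeft d e ≪≫ α, hc', ⟨?_ ≪≫ i⟩⟩
  exact Cone.ext (e.app c.pt) fun j => by simp

theorem IsoMemCocones.of_iso {C D : Type (w + 1)} [Category.{w} C] [Category.{w} D]
    {K : Set (DiagramCocone D)} {J : Type (w + 1)} [Category.{w} J] [EssentiallySmall.{w} J]
    {d : J ⥤ C} {c : Cocone d} {F G : C ⥤ D} (e : F ≅ G) (h : IsoMemCocones K (G.mapCocone c)) :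
    IsoMemCocones K (F.mapCocone c) := by
  obtain ⟨d', c', α, hc', ⟨i⟩⟩ := h
  refine ⟨d', c', Functor.isoWhiskerLeft d e ≪≫ α, hc', ⟨?_ ≪≫ i⟩⟩
  exact Cocone.ext (e.app c.pt) fun j => by simp

theorem IsoMemCocones.nonempty_isColimit {C : Type (w + 1)} [Category.{w} C]
    {K : Set (DiagramCocone C)} (hK : ∀ c ∈ K, Nonempty (IsColimit c.cocone))
    {J : Type (w + 1)} [Category.{w} J] [EssentiallySmall.{w} J] {d : J ⥤ C} {c : Cocone d}
    (h : IsoMemCocones K c) : Nonempty (IsColimit c) := by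
  obtain ⟨d', c', α, hc', ⟨i⟩⟩ := h
  obtain ⟨h'⟩ := hK _ hc'
  exact ⟨(IsColimit.precomposeInvEquiv α c) (h'.ofIsoColimit i.symm)⟩

namespace SmallSketch

/-- A morphism `f` into a left normal sketch sends the distinguished cocones to colimit cocones, so
the presheaves `a ↦ (f a ⟶ t)` belong to the classifier. -/
theorem isLocal_comp_yoneda {S T : SmallSketch.{w}} (f : S ⟶ T) (hT : T.LeftNormal)
    (t : T.carrier) : S.comparisons.isLocal (f.functor.op ⋙ yoneda.obj t) := by
  rintro _ _ _ ⟨c, hc⟩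
  obtain ⟨h⟩ := (f.map_cocones c hc).nonempty_isColimit hT
  let X := f.functor.op ⋙ yoneda.obj t
  have key (g : yoneda.obj c.cocone.pt ⟶ X) (j : c.shape) :
      yonedaEquiv (colimit.ι (c.diagram ⋙ yoneda) j ≫ comparison c ≫ g) =
        f.functor.map (c.cocone.ι.app j) ≫ (yonedaEquiv g : f.functor.obj c.cocone.pt ⟶ t) := by
    rw [comparison, colimit.ι_desc_assoc]
    exact (yonedaEquiv_naturality g (c.cocone.ι.app j)).symm
  refine ⟨fun a b hab => ?_, fun u => ?_⟩
  · refine yonedaEquiv.injective (h.hom_ext fun j => ?_)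
    exact (key a j).symm.trans ((congrArg
      (fun u => yonedaEquiv (colimit.ι (c.diagram ⋙ yoneda) j ≫ u)) hab).trans
      (key b j))
  · let s : Cocone (c.diagram ⋙ f.functor) :=
      { pt := t
        ι :=
          { app j := (yonedaEquiv (colimit.ι (c.diagram ⋙ yoneda) j ≫ u) :
              f.functor.obj (c.diagram.obj j) ⟶ t)
            naturality j j' k := by
              have h1 := colimit.w_assoc (c.diagram ⋙ yoneda) k u
              have h2 := yonedaEquiv_naturality (colimit.ι (c.diagram ⋙ yoneda) j' ≫ u)
                (c.diagram.map k)
              refine (h2.trans (congrArg yonedaEquiv h1)).trans (Category.comp_id _).symm } }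
    refine ⟨yonedaEquiv.symm (h.desc s), colimit.hom_ext fun j => yonedaEquiv.injective ?_⟩
    refine (key _ j).trans ?_
    rw [Equiv.apply_symm_apply]
    exact h.fac s j

namespace Factorisation

variable {S T : SmallSketch.{w}} [S.classifierInclusion.IsRightAdjoint] (N : S.Factorisation)

theorem natTrans_ext {b : S.carrier} {X : S.carrierᵒᵖ ⥤ Type w} (hX : S.comparisons.isLocal X)
    {θ θ' : N.P.op ⋙ yoneda.obj (N.P.obj b) ⟶ X}
    (h : θ.app (op b) (𝟙 (N.P.obj b)) = θ'.app (op b) (𝟙 (N.P.obj b))) : θ = θ' :=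
  (N.existsUnique_natTrans hX _).unique h rfl

section Lift

variable (hT : T.LeftNormal) (f : S ⟶ T)

/-- The map of presheaves `(P a ⟶ P b) → (f a ⟶ f b)` sending the identity of `P b` to
that of `f b`. -/
noncomputable def extendNatTrans (b : S.carrier) :
    N.P.op ⋙ yoneda.obj (N.P.obj b) ⟶ f.functor.op ⋙ yoneda.obj (f.functor.obj b) :=
  (N.existsUnique_natTrans (isLocal_comp_yoneda f hT (f.functor.obj b)) (𝟙 _)).choose

/-- The action of the extension of `f` along `P` on the morphisms between objects of the form
`P a`. -/
noncomputable def extend {a b : S.carrier} (φ : N.P.obj a ⟶ N.P.obj b) :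
    f.functor.obj a ⟶ f.functor.obj b :=
  (N.extendNatTrans hT f b).app (op a) φ

theorem extend_id (b : S.carrier) : N.extend hT f (𝟙 (N.P.obj b)) = 𝟙 _ :=
  (N.existsUnique_natTrans (isLocal_comp_yoneda f hT (f.functor.obj b)) (𝟙 _)).choose_spec.1

theorem extend_map_comp {a a' b : S.carrier} (k : a ⟶ a') (φ : N.P.obj a' ⟶ N.P.obj b) :
    N.extend hT f (N.P.map k ≫ φ) = f.functor.map k ≫ N.extend hT f φ :=
  NatTrans.naturality_apply (N.extendNatTrans hT f b) k.op φ

theorem extend_map {a b : S.carrier} (k : a ⟶ b) :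
    N.extend hT f (N.P.map k) = f.functor.map k := by
  simpa [extend_id] using N.extend_map_comp hT f k (𝟙 _)

/-- Both sides are natural in `a` and agree for `φ` the identity. -/
theorem extend_comp {a b c : S.carrier} (φ : N.P.obj a ⟶ N.P.obj b) (ψ : N.P.obj b ⟶ N.P.obj c) :
    N.extend hT f (φ ≫ ψ) = N.extend hT f φ ≫ N.extend hT f ψ := by
  have := N.natTrans_ext (isLocal_comp_yoneda f hT (f.functor.obj c))
    (θ := Functor.whiskerLeft N.P.op (yoneda.map ψ) ≫ N.extendNatTrans hT f c)
    (θ' := N.extendNatTrans hT f b ≫ Functor.whiskerLeft f.functor.op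
      (yoneda.map (N.extend hT f ψ))) (by
        change N.extend hT f (𝟙 _ ≫ ψ) = N.extend hT f (𝟙 _) ≫ N.extend hT f ψ
        simp [extend_id])
  exact congr($(congrArg (fun θ => NatTrans.app θ (op a)) this) φ)

/-- The extension of `f` along `P`, defined on an object by means of a chosen preimage up to
isomorphism. -/
noncomputable def liftFunctor : N.middle ⥤ T.carrier :=
  have := N.essSurj
  { obj m := f.functor.obj (N.P.objPreimage m)
    map {m m'} φ := N.extend hT f
      ((N.P.objObjPreimageIso m).hom ≫ φ ≫ (N.P.objObjPreimageIso m').inv)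
    map_id m := by simp [extend_id]
    map_comp φ ψ := by simp [← extend_comp] }

/-- The extension of `f` along `P` restricts to `f`. -/
noncomputable def compLiftFunctorIso : N.P ⋙ N.liftFunctor hT f ≅ f.functor :=
  have := N.essSurj
  NatIso.ofComponents (fun a =>
    { hom := N.extend hT f (N.P.objObjPreimageIso (N.P.obj a)).hom
      inv := N.extend hT f (N.P.objObjPreimageIso (N.P.obj a)).inv
      hom_inv_id := (N.extend_comp hT f _ _).symm.trans (by rw [Iso.hom_inv_id, extend_id]; rfl)
      inv_hom_id := (N.extend_comp hT f _ _).symm.trans (by rw [Iso.inv_hom_id, extend_id]) })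
    fun {a b} k => by
    simp [liftFunctor, ← extend_map N hT, ← extend_comp]

/-- The extension of `f` along `P` is a morphism of sketches, because the distinguished (co)cones
of the left normalisation are images under `P`. -/
noncomputable def lift : N.sketch ⟶ T where
  functor := N.liftFunctor hT f
  map_cones := by
    rintro _ ⟨c, hc, rfl⟩
    exact IsoMemCones.of_iso (c := c.cone) (N.compLiftFunctorIso hT f) (f.map_cones c hc)
  map_cocones := by
    rintro _ ⟨c, hc, rfl⟩
    exact IsoMemCocones.of_iso (c := c.cocone) (N.compLiftFunctorIso hT f) (f.map_cocones c hc)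

/-- The isomorphism `compLiftFunctorIso` as an invertible 2-cell. -/
noncomputable def unitCompLiftIso : N.unit ≫ N.lift hT f ≅ f :=
  isoMk (N.compLiftFunctorIso hT f)

end Lift

theorem natTrans_ext_of_comp {D : Type*} [Category* D] {h k : N.middle ⥤ D} {α β : h ⟶ k}
    (H : ∀ a, α.app (N.P.obj a) = β.app (N.P.obj a)) : α = β := by
  have := N.essSurj
  ext m
  rw [← cancel_epi (h.map (N.P.objObjPreimageIso m).hom), α.naturality, β.naturality, H]

/-- A transformation of functors restricted along `P` is automatically natural for all morphisms
`P a ⟶ P b`, by the uniqueness in the universal property of these homs, and hence extends. -/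
theorem exists_natTrans {D : Type (w + 1)} [Category.{w} D] {h k : N.middle ⥤ D}
    (hh : ∀ t, S.comparisons.isLocal ((N.P ⋙ h).op ⋙ yoneda.obj t)) (α : N.P ⋙ h ⟶ N.P ⋙ k) :
    ∃ β : h ⟶ k, ∀ a, β.app (N.P.obj a) = α.app a := by
  have := N.essSurj
  -- Both sides are maps of presheaves in `a` which agree at the identity of `P b`.
  have key {a b : S.carrier} (φ : N.P.obj a ⟶ N.P.obj b) :
      h.map φ ≫ α.app b = α.app a ≫ k.map φ := by
    have := N.natTrans_ext (hh (k.obj (N.P.obj b))) (b := b)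
      (θ :=
        { app a := TypeCat.ofHom fun φ : N.P.obj a.unop ⟶ N.P.obj b =>
            (h.map φ ≫ α.app b : h.obj (N.P.obj a.unop) ⟶ k.obj (N.P.obj b))
          naturality a a' g := by
            ext φ
            simp })
      (θ' :=
        { app a := TypeCat.ofHom fun φ : N.P.obj a.unop ⟶ N.P.obj b =>
            (α.app a.unop ≫ k.map φ : h.obj (N.P.obj a.unop) ⟶ k.obj (N.P.obj b))
          naturality a a' g := by
            ext φ
            have := α.naturality g.unop
            dsimp at this
            simp [reassoc_of% this] })
      (by simp)
    exact congr($(congrArg (fun θ => NatTrans.app θ (op a)) this) φ)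
  have key' {a b : S.carrier} (φ : N.P.obj a ⟶ N.P.obj b) {t : D} (ψ : k.obj (N.P.obj b) ⟶ t) :
      h.map φ ≫ α.app b ≫ ψ = α.app a ≫ k.map φ ≫ ψ := by
    rw [← Category.assoc]
    simp [key]
  let e := N.P.objObjPreimageIso
  refine ⟨{
    app m := h.map (e m).inv ≫ α.app (N.P.objPreimage m) ≫ k.map (e m).hom
    naturality m m' φ := ?_ }, fun a => ?_⟩
  · have h1 : φ ≫ (e m').inv = (e m).inv ≫ ((e m).hom ≫ φ ≫ (e m').inv) := by simp
    rw [← Category.assoc, ← h.map_comp, h1, h.map_comp, Category.assoc, key',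
      ← k.map_comp]
    simp
  · dsimp only
    rw [← key, ← Category.assoc, ← h.map_comp, Iso.inv_hom_id, h.map_id]
    exact Category.id_comp _

theorem isEquivalence_precomp_unit (hT : T.LeftNormal) :
    (Bicategory.precomp T N.unit).IsEquivalence where
  faithful := ⟨fun {h k α β} H => Hom₂.ext <|
    N.natTrans_ext_of_comp (h := h.functor) (k := k.functor) fun a =>
      congrArg (fun γ : Hom₂ (Hom.comp N.unit h) (Hom.comp N.unit k) => γ.natTrans.app a) H⟩
  full := ⟨fun {h k} α => by
    obtain ⟨β, hβ⟩ := N.exists_natTrans (h := h.functor) (k := k.functor)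
      (isLocal_comp_yoneda (N.unit ≫ h) hT) α.natTrans
    exact ⟨⟨β⟩, hom₂_eq hβ⟩⟩
  essSurj := ⟨fun f => ⟨N.lift hT f, ⟨N.unitCompLiftIso hT f⟩⟩⟩

end Factorisation
end SmallSketch

/-! ### Biadjunctions from universal arrows -/

namespace BiadjunctionOfUniversal

open Bicategory

theorem whiskerLeft_whiskerRight {B : Type*} [Bicategory B] {a b c d : B} (f : a ⟶ b)
    {g h : b ⟶ c} (θ : g ⟶ h) (k : c ⟶ d) :
    f ◁ θ ▷ k = (α_ _ _ _).inv ≫ (f ◁ θ) ▷ k ≫ (α_ _ _ _).hom := by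
  simp

variable {B D : Type*} [Bicategory B] {i : D → B} {obj : B → D} (η : ∀ X, X ⟶ i (obj X))
  [hη : ∀ X Y, (precomp (i Y) (η X)).IsEquivalence]

/-- The essentially unique extension of `f ≫ η Y` along `η X`. -/
noncomputable def map {X Y : B} (f : X ⟶ Y) : i (obj X) ⟶ i (obj Y) :=
  (precomp _ (η X)).objPreimage (f ≫ η Y)

/-- The invertible 2-cell witnessing that `map η f` extends `f ≫ η Y` along `η X`. -/
noncomputable def mapIso {X Y : B} (f : X ⟶ Y) : η X ≫ map η f ≅ f ≫ η Y :=
  (precomp _ (η X)).objObjPreimageIso (f ≫ η Y)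

/-- 2-cells between 1-morphisms out of `i (obj X)` can be compared after whiskering with `η X`. -/
theorem hom_ext {X : B} {Y : D} {g h : i (obj X) ⟶ i Y} {α β : g ⟶ h}
    (H : η X ◁ α = η X ◁ β) : α = β :=
  (precomp (i Y) (η X)).map_injective H

/-- The invertible 2-cell whose whiskering with `η X` is `e`. -/
noncomputable def descIso {X : B} {Y : D} {g h : i (obj X) ⟶ i Y} (e : η X ≫ g ≅ η X ≫ h) :
    g ≅ h :=
  (precomp (i Y) (η X)).preimageIso e

@[simp]
theorem whiskerLeft_descIso_hom {X : B} {Y : D} {g h : i (obj X) ⟶ i Y} (e : η X ≫ g ≅ η X ≫ h) :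
    η X ◁ (descIso η e).hom = e.hom :=
  (precomp (i Y) (η X)).map_preimage _

@[simp]
theorem whiskerLeft_descIso_inv {X : B} {Y : D} {g h : i (obj X) ⟶ i Y} (e : η X ≫ g ≅ η X ≫ h) :
    η X ◁ (descIso η e).inv = e.inv :=
  (precomp (i Y) (η X)).map_preimage _

/-- The action of `map η` on 2-cells, transported along `mapIso`. -/
noncomputable def map₂ {X Y : B} {f g : X ⟶ Y} (α : f ⟶ g) : map η f ⟶ map η g :=
  (precomp _ (η X)).preimage ((mapIso η f).hom ≫ α ▷ η Y ≫ (mapIso η g).inv)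

@[simp]
theorem whiskerLeft_map₂ {X Y : B} {f g : X ⟶ Y} (α : f ⟶ g) :
    η X ◁ map₂ η α = (mapIso η f).hom ≫ α ▷ η Y ≫ (mapIso η g).inv :=
  (precomp _ (η X)).map_preimage _

/-- The unit constraint of `map η`. -/
noncomputable def mapId (X : B) : map η (𝟙 X) ≅ 𝟙 _ :=
  descIso η (mapIso η (𝟙 X) ≪≫ λ_ (η X) ≪≫ (ρ_ (η X)).symm)

/-- The composition constraint of `map η`. -/
noncomputable def mapComp {X Y Z : B} (f : X ⟶ Y) (g : Y ⟶ Z) :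
    map η (f ≫ g) ≅ map η f ≫ map η g :=
  descIso η (mapIso η (f ≫ g) ≪≫ α_ f g (η Z) ≪≫ whiskerLeftIso f (mapIso η g).symm ≪≫
    (α_ f (η Y) (map η g)).symm ≪≫ whiskerRightIso (mapIso η f).symm (map η g) ≪≫
      α_ (η X) (map η f) (map η g))

@[simp]
theorem whiskerLeft_descIso_hom_whiskerRight {X : B} {Y Z : D} {g h : i (obj X) ⟶ i Y}
    (e : η X ≫ g ≅ η X ≫ h) (k : i Y ⟶ i Z) :
    η X ◁ (descIso η e).hom ▷ k = (α_ _ _ _).inv ≫ e.hom ▷ k ≫ (α_ _ _ _).hom := by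
  rw [whiskerLeft_whiskerRight, whiskerLeft_descIso_hom]

@[simp]
theorem whiskerLeft_map₂_whiskerRight {X Y : B} {Z : D} {f g : X ⟶ Y} (α : f ⟶ g)
    (k : i (obj Y) ⟶ i Z) :
    η X ◁ map₂ η α ▷ k = (α_ _ _ _).inv ≫
      ((mapIso η f).hom ≫ α ▷ η Y ≫ (mapIso η g).inv) ▷ k ≫ (α_ _ _ _).hom := by
  rw [whiskerLeft_whiskerRight, whiskerLeft_map₂]

/-- Moves `η X` past `map η f`, after which whiskering with `η Y` can be evaluated on `θ`. As a
simp lemma, this reduces the axioms of the pseudofunctor to coherence in `B`. -/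
@[simp]
theorem whiskerLeft_map_whiskerLeft {X Y : B} (f : X ⟶ Y) {Z : D} {g h : i (obj Y) ⟶ i Z}
    (θ : g ⟶ h) : η X ◁ map η f ◁ θ =
      (α_ _ _ _).inv ≫ (mapIso η f).hom ▷ g ≫ (α_ _ _ _).hom ≫ f ◁ η Y ◁ θ ≫
        (α_ _ _ _).inv ≫ (mapIso η f).inv ▷ h ≫ (α_ _ _ _).hom := by
  have := whisker_exchange (mapIso η f).hom θ
  rw [comp_whiskerLeft, comp_whiskerLeft] at this
  simp [← reassoc_of% this]

theorem map₂_whisker_left {X Y Z : B} (f : X ⟶ Y) {g h : Y ⟶ Z} (θ : g ⟶ h) :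
    map₂ η (f ◁ θ) = (mapComp η f g).hom ≫ map η f ◁ map₂ η θ ≫ (mapComp η f h).inv := by
  apply hom_ext η
  simp [mapComp]

theorem map₂_whisker_right {X Y Z : B} {f g : X ⟶ Y} (θ : f ⟶ g) (h : Y ⟶ Z) :
    map₂ η (θ ▷ h) = (mapComp η f h).hom ≫ map₂ η θ ▷ map η h ≫ (mapComp η g h).inv := by
  apply hom_ext η
  have := whisker_exchange θ (mapIso η h).inv
  rw [whiskerRight_comp, whiskerRight_comp] at this
  simp [mapComp, reassoc_of% this]

theorem map₂_associator {X Y Z W : B} (f : X ⟶ Y) (g : Y ⟶ Z) (h : Z ⟶ W) :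
    map₂ η (α_ f g h).hom = (mapComp η (f ≫ g) h).hom ≫ (mapComp η f g).hom ▷ map η h ≫
      (α_ (map η f) (map η g) (map η h)).hom ≫ map η f ◁ (mapComp η g h).inv ≫
      (mapComp η f (g ≫ h)).inv := by
  apply hom_ext η
  simp [mapComp]

theorem map₂_leftUnitor {X Y : B} (f : X ⟶ Y) :
    map₂ η (λ_ f).hom =
      (mapComp η (𝟙 X) f).hom ≫ (mapId η X).hom ▷ map η f ≫ (λ_ (map η f)).hom := by
  apply hom_ext η
  simp [mapComp, mapId]

theorem map₂_rightUnitor {X Y : B} (f : X ⟶ Y) :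
    map₂ η (ρ_ f).hom =
      (mapComp η f (𝟙 Y)).hom ≫ map η f ◁ (mapId η Y).hom ≫ (ρ_ (map η f)).hom := by
  apply hom_ext η
  simp [mapComp, mapId]

/-- The pseudofunctor into a full sub-bicategory assembled from the universal arrows
`η X : X ⟶ i (obj X)`. -/
noncomputable def pseudofunctor : Pseudofunctor B (InducedBicategory B i) where
  obj := obj
  map f := InducedBicategory.mkHom (map η f)
  map₂ α := InducedBicategory.mkHom₂ (map₂ η α)
  map₂_id f := by
    refine InducedBicategory.hom₂_ext (hom_ext η ?_)
    change η _ ◁ map₂ η (𝟙 f) = η _ ◁ 𝟙 (map η f)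
    simp
  map₂_comp f g := by
    refine InducedBicategory.hom₂_ext (hom_ext η ?_)
    change η _ ◁ map₂ η (f ≫ g) = η _ ◁ (map₂ η f ≫ map₂ η g)
    simp
  mapId X := InducedBicategory.isoMk (mapId η X)
  mapComp f g := InducedBicategory.isoMk (mapComp η f g)
  map₂_whisker_left f _ _ θ := InducedBicategory.hom₂_ext (map₂_whisker_left η f θ)
  map₂_whisker_right θ h := InducedBicategory.hom₂_ext (map₂_whisker_right η θ h)
  map₂_associator f g h := InducedBicategory.hom₂_ext (map₂_associator η f g h)
  map₂_left_unitor f := InducedBicategory.hom₂_ext (map₂_leftUnitor η f)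
  map₂_right_unitor f := InducedBicategory.hom₂_ext (map₂_rightUnitor η f)

/-- The universal arrows `η X` as a pseudonatural transformation. -/
noncomputable def unit : Pseudofunctor.StrongTrans (Pseudofunctor.id B)
    ((pseudofunctor η).comp InducedBicategory.forget.toPseudofunctor) where
  app := η
  naturality f := (mapIso η f).symm
  naturality_naturality {X Y f g} θ := by
    change θ ▷ η Y ≫ (mapIso η g).inv = (mapIso η f).inv ≫ η X ◁ map₂ η θ
    simp
  naturality_id X := by
    change (mapIso η (𝟙 X)).inv ≫ η X ◁ ((mapId η X).hom ≫ 𝟙 _) =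
      𝟙 _ ▷ η X ≫ (λ_ _).hom ≫ (ρ_ _).inv
    simp [mapId]
  naturality_comp {X Y Z} f g := by
    change (mapIso η (f ≫ g)).inv ≫ η X ◁ ((mapComp η f g).hom ≫ 𝟙 _) =
      𝟙 (f ≫ g) ▷ η Z ≫ (α_ _ _ _).hom ≫ f ◁ (mapIso η g).inv ≫ (α_ _ _ _).inv ≫
        (mapIso η f).inv ▷ map η g ≫ (α_ _ _ _).hom
    simp [mapComp]

/-- Universal arrows from the objects of a bicategory to a full sub-bicategory assemble into a left
biadjoint of the inclusion, with these arrows as the components of the unit. -/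
noncomputable def biadjunction :
    Biadjunction (pseudofunctor η) (InducedBicategory.forget (F := i)).toPseudofunctor where
  unit := unit η
  isEquivalence X Y := by
    have : ((InducedBicategory.forget (F := i)).toPseudofunctor.mapFunctor
        ((pseudofunctor η).obj X) Y).IsEquivalence :=
      { faithful := ⟨fun h => InducedBicategory.hom₂_ext h⟩
        full := ⟨fun α => ⟨⟨α⟩, rfl⟩⟩
        essSurj := ⟨fun g => ⟨InducedBicategory.mkHom g, ⟨Iso.refl _⟩⟩⟩ }
    exact @Functor.isEquivalence_trans _ _ _ _ _ _ _ _ this (hη X Y)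

end BiadjunctionOfUniversal

/-! ### The biadjunction of left normalisation -/

theorem mainTheorem8 :
    ∃ _ : ∀ S : SmallSketch.{w}, S.classifierInclusion.IsRightAdjoint,
      (∀ S : SmallSketch.{w}, Nonempty S.Factorisation) ∧
      ∀ N : ∀ S : SmallSketch.{w}, S.Factorisation,
        ∃ (hN : ∀ S : SmallSketch.{w}, (N S).sketch.LeftNormal)
          (F : Pseudofunctor SmallSketch.{w} LeftNormalSketch.{w})
          (A : Biadjunction F LeftNormalSketch.inclusion.{w}),
          ∀ S : SmallSketch.{w},
            (⟨F.obj S, A.unit.app S⟩ :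
              Σ T : LeftNormalSketch.{w}, S ⟶ LeftNormalSketch.inclusion.obj T) =
            ⟨LeftNormalSketch.of (N S).sketch (hN S), (N S).unit⟩ := by
  refine ⟨SmallSketch.isRightAdjoint_classifierInclusion, fun S => ?_, fun N => ?_⟩
  · have := S.isRightAdjoint_classifierInclusion
    exact S.nonempty_factorisation
  · have (S : SmallSketch.{w}) := S.isRightAdjoint_classifierInclusion
    have hN S := (N S).leftNormal_sketch
    let obj (S : SmallSketch.{w}) : {T : SmallSketch.{w} // T.LeftNormal} := ⟨(N S).sketch, hN S⟩
    let η (S : SmallSketch.{w}) : S ⟶ (obj S).1 := (N S).unit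
    have hη (S : SmallSketch.{w}) (T : {T : SmallSketch.{w} // T.LeftNormal}) :
        (Bicategory.precomp T.1 (η S)).IsEquivalence := (N S).isEquivalence_precomp_unit T.2
    exact ⟨hN, BiadjunctionOfUniversal.pseudofunctor η, BiadjunctionOfUniversal.biadjunction η,
      fun S => rfl⟩
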